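/- All groups and graphs are finite. For a group $G$, let $\mathcal P(G)$ be the power graph of $G$: its vertices are the nontrivial elements of $G$, and two distinct vertices are adjacent if one is a power of the other. For a graph $L$, let $\overline L$ be the weighted graph whose vertices are the classes $\bar x$ of vertices of $L$ for the relation "equal closed neighborhoods in $L$", where distinct classes $\bar x,\bar y$ are adjacent if $x,y$ are adjacent in $L$, and where the weight of $\bar x$ is $|\bar x|$; automorphisms of a weighted graph are required to preserve weights. For a nontrivial $x\in G$ let $\widehat x=\overline{L_x}$, where $L_x$ is the subgraph of $\mathcal P(G)$ induced on $N(x)\setminus\langle x\rangle$, with $N(x)$ the neighborhood of $x$ in $\mathcal P(G)$. Let $p$ be a prime and $G$ a finite abelian $p$-group. The height of a nontrivial $x\in G$ is the largest power $p^n$ such that $x\in G^{p^n}=\{g^{p^n}: g\in G\}$. For $t\ge 1$ let $H_t(G)$ be the set of elements of $G$ of order $p$ and height $p^{t-1}$. For each $t\geq 1$ with $H_t(G)\neq\emptyset$ choose an arbitrary element $\alpha_t\in H_t(G)$. Then $p-1$ divides $|H_t(G)|$ for every such $t$, and $$\operatorname{Aut}(\overline{\mathcal P(G)})\;\cong\;\prod_{t\ge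 1,\ H_t(G)\neq\emptyset}\operatorname{Aut}(\widehat{\alpha_t})\wr S_{|H_t(G)|/(p-1)},$$ where $A\wr S_n$ denotes the semidirect product $A^n\rtimes S_n$ in which $S_n$ permutes the $n$ coordinates. -/

import Mathlib

namespace PowerGraph

universe u

/-- A simple graph whose vertices carry a natural number weight. -/
structure WeightedGraph (V : Type u) where
  graph : SimpleGraph V
  weight : V → ℕ

/-- The automorphism group of a weighted graph: the graph automorphisms that preserve the
weight of every vertex. -/
def WeightedGraph.Aut {V : Type u} (W : WeightedGraph V) : Subgroup (W.graph ≃g W.graph) where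
  carrier := {φ | ∀ v, W.weight (φ v) = W.weight v}
  one_mem' := fun _ => rfl
  mul_mem' := by
    intro φ ψ hφ hψ v
    exact (hφ (ψ v)).trans (hψ v)
  inv_mem' := by
    intro φ hφ v
    have h := hφ (φ.symm v)
    rw [RelIso.apply_symm_apply] at h
    exact h.symm

/-- The closed neighborhood `N[a] = N(a) ∪ {a}`. -/
def closedNeighborSet {V : Type u} (L : SimpleGraph V) (a : V) : Set V :=
  L.neighborSet a ∪ {a}

/-- Two vertices are related when they have equal closed neighborhoods. The equivalence classes
are the maximal sets of vertices any two of which have equal closed neighborhoods. -/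
def menSetoid {V : Type u} (L : SimpleGraph V) : Setoid V :=
  Setoid.ker (closedNeighborSet L)

/-- The weighted graph `L̄`: its vertices are the classes `x̄` of vertices of `L` with equal closed
neighborhoods, distinct classes `x̄`, `ȳ` are adjacent when `x`, `y` are adjacent in `L`, and the
weight of a class is its cardinality. -/
noncomputable def bar {V : Type u} (L : SimpleGraph V) : WeightedGraph (Quotient (menSetoid L)) where
  graph := SimpleGraph.fromRel fun A B =>
    ∃ x y : V, Quotient.mk (menSetoid L) x = A ∧ Quotient.mk (menSetoid L) y = B ∧ L.Adj x y
  weight A := Set.ncard {x : V | Quotient.mk (menSetoid L) x = A}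

/-- The power graph of `G`: its vertices are the nontrivial elements, and two distinct vertices are
adjacent when one is a power of the other. -/
def powerGraph (G : Type u) [Group G] : SimpleGraph {x : G // x ≠ 1} :=
  SimpleGraph.fromRel fun x y => ∃ m : ℕ, 0 < m ∧ (y : G) = (x : G) ^ m

/-- The weighted graph `x̂`, that is `L̄` for `L` the subgraph of the power graph induced on
`N(x) - ⟨x⟩`. -/
noncomputable def hat {G : Type u} [Group G] (x : {x : G // x ≠ 1}) :
    WeightedGraph (Quotient (menSetoid ((powerGraph G).induce
      {y | y ∈ (powerGraph G).neighborSet x ∧ (y : G) ∉ Subgroup.zpowers (x : G)}))) :=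
  bar ((powerGraph G).induce
    {y | y ∈ (powerGraph G).neighborSet x ∧ (y : G) ∉ Subgroup.zpowers (x : G)})

/-- `HasHeight p x m` says that `height x = m`: among the powers `p ^ n` of `p` such that `x` lies
in the subgroup `G ^ (p ^ n)` of `p ^ n`-th powers, `m` is the largest. -/
def HasHeight {G : Type u} [CommGroup G] (p : ℕ) (x : G) (m : ℕ) : Prop :=
  IsGreatest {k : ℕ | ∃ n : ℕ, k = p ^ n ∧ x ∈ (powMonoidHom (p ^ n) : G →* G).range} m

/-- `H p G t` is the set `H_t(G)` of the elements of order `p` and height `p ^ (t - 1)`; it is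
meant for `t ≥ 1`. -/
def H (p : ℕ) (G : Type u) [CommGroup G] (t : ℕ) : Set {x : G // x ≠ 1} :=
  {x | orderOf (x : G) = p ∧ HasHeight p (x : G) (p ^ (t - 1))}

/-- The wreath product `A ≀ S_n`: the semidirect product of `A ^ n` by the symmetric group on `n`
letters, which permutes the coordinates. -/
abbrev WreathSym (A : Type u) [Group A] (n : ℕ) : Type u :=
  (Fin n → A) ⋊[mulAutArrow (G := Equiv.Perm (Fin n)) (A := Fin n) (M := A)] Equiv.Perm (Fin n)

end PowerGraph

/-! In a finite `p`-group a nontrivial element has exactly one subgroup of order `p` among its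
powers, and adjacent elements share it. So the components of the power graph correspond to the
subgroups of order `p`, and a generator of such a subgroup is adjacent to the rest of its component.
The class graph inherits this shape, and its automorphisms permute the components because each has a
dominating vertex.

Two components lie in one orbit exactly when their subgroups have the same height. If the heights
agree, `exists_mulEquiv_apply_eq` gives a group automorphism matching the subgroups: an element of
order `p` and height `p ^ h` lies in a cyclic direct factor of order `p ^ (h + 1)`, and a complement
can be shared. If the heights differ, so do the sizes of the components (`ncard_mem_zpowers_lt`),
and weights record sizes.

Hence `nonempty_aut_mulEquiv_pi_wreath` gives a product over heights of wreath products; a subgroup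
of order `p` has `p - 1` generators, so `H_t` accounts for its cardinality over `p - 1` components.
Finally, `hat a` comes from the component of `a` by deleting `⟨a⟩`, which consists of dominating
elements. The dominating class is unique and hence fixed, so shrinking or losing it leaves the
automorphism group unchanged (`nonempty_bar_induce_aut_mulEquiv`). -/

namespace PowerGraph

universe u

/-! ### Automorphisms of weighted graphs whose components have dominating vertices -/

namespace WeightedGraph

variable {V V' : Type u}

/-- The weighted graph induced on a set of vertices. -/
def induce (W : WeightedGraph V) (s : Set V) : WeightedGraph s where
  graph := W.graph.induce s
  weight v := W.weight v

/-- The automorphism of a weighted graph given by a permutation of the vertices. -/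
def autOfPerm (W : WeightedGraph V) (σ : Equiv.Perm V)
    (hadj : ∀ v w, W.graph.Adj (σ v) (σ w) ↔ W.graph.Adj v w)
    (hw : ∀ v, W.weight (σ v) = W.weight v) : W.Aut :=
  ⟨⟨σ, hadj _ _⟩, hw⟩

@[simp]
theorem autOfPerm_apply (W : WeightedGraph V) (σ : Equiv.Perm V)
    (hadj : ∀ v w, W.graph.Adj (σ v) (σ w) ↔ W.graph.Adj v w)
    (hw : ∀ v, W.weight (σ v) = W.weight v) (v : V) :
    (W.autOfPerm σ hadj hw : W.graph ≃g W.graph) v = σ v := rfl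

theorem aut_ext {W : WeightedGraph V} {φ ψ : W.Aut}
    (h : ∀ v, (φ : W.graph ≃g W.graph) v = (ψ : W.graph ≃g W.graph) v) : φ = ψ :=
  Subtype.ext (RelIso.ext h)

theorem aut_adj {W : WeightedGraph V} (φ : W.Aut) (v w : V) :
    W.graph.Adj ((φ : W.graph ≃g W.graph) v) ((φ : W.graph ≃g W.graph) w) ↔ W.graph.Adj v w :=
  (φ : W.graph ≃g W.graph).map_rel_iff

theorem aut_weight {W : WeightedGraph V} (φ : W.Aut) (v : V) :
    W.weight ((φ : W.graph ≃g W.graph) v) = W.weight v := φ.2 v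

@[simp]
theorem aut_mul_apply {W : WeightedGraph V} (φ ψ : W.Aut) (v : V) :
    ((φ * ψ : W.Aut) : W.graph ≃g W.graph) v
      = (φ : W.graph ≃g W.graph) ((ψ : W.graph ≃g W.graph) v) := rfl

@[simp]
theorem aut_one_apply {W : WeightedGraph V} (v : V) :
    ((1 : W.Aut) : W.graph ≃g W.graph) v = v := rfl

@[simp]
theorem aut_inv_apply_self {W : WeightedGraph V} (φ : W.Aut) (v : V) :
    ((φ⁻¹ : W.Aut) : W.graph ≃g W.graph) ((φ : W.graph ≃g W.graph) v) = v := by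
  rw [← aut_mul_apply, inv_mul_cancel, aut_one_apply]

@[simp]
theorem aut_apply_inv_self {W : WeightedGraph V} (φ : W.Aut) (v : V) :
    (φ : W.graph ≃g W.graph) (((φ⁻¹ : W.Aut) : W.graph ≃g W.graph) v) = v := by
  rw [← aut_mul_apply, mul_inv_cancel, aut_one_apply]

/-- Isomorphic weighted graphs have isomorphic automorphism groups. -/
def autCongr {W : WeightedGraph V} {W' : WeightedGraph V'} (e : V ≃ V')
    (hadj : ∀ v w, W'.graph.Adj (e v) (e w) ↔ W.graph.Adj v w)
    (hw : ∀ v, W'.weight (e v) = W.weight v) : W.Aut ≃* W'.Aut where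
  toFun φ := W'.autOfPerm (e.permCongr (φ : W.graph ≃g W.graph).toEquiv)
    (fun v w => by
      obtain ⟨v, rfl⟩ := e.surjective v
      obtain ⟨w, rfl⟩ := e.surjective w
      simpa [hadj] using aut_adj φ v w)
    (fun v => by
      obtain ⟨v, rfl⟩ := e.surjective v
      simpa [hw] using aut_weight φ v)
  invFun φ := W.autOfPerm (e.symm.permCongr (φ : W'.graph ≃g W'.graph).toEquiv)
    (fun v w => by
      rw [← hadj, ← hadj]
      simpa using aut_adj φ (e v) (e w))
    (fun v => by
      rw [← hw, ← hw]
      simpa using aut_weight φ (e v))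
  left_inv φ := aut_ext fun v => by simp
  right_inv φ := aut_ext fun v => by simp
  map_mul' φ ψ := aut_ext fun v => by simp

/-- Restriction of automorphisms to a set of vertices that all of them preserve. -/
def restrictAut (W : WeightedGraph V) (s : Set V)
    (h : ∀ (φ : W.Aut) (v : V), (φ : W.graph ≃g W.graph) v ∈ s ↔ v ∈ s) :
    W.Aut →* (W.induce s).Aut where
  toFun φ := (W.induce s).autOfPerm
    (Equiv.Perm.subtypePerm (φ : W.graph ≃g W.graph).toEquiv fun v => h φ v)
    (fun v w => aut_adj φ v w) (fun v => aut_weight φ v)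
  map_one' := aut_ext fun _ => rfl
  map_mul' _ _ := aut_ext fun _ => rfl

/-- If adjacent vertices have the same type and automorphisms preserve types, then the
automorphism group is the product of those of the parts of each type. -/
theorem nonempty_aut_mulEquiv_pi (W : WeightedGraph V) {T : Type*} (τ : V → T)
    (hadj : ∀ v w, W.graph.Adj v w → τ v = τ w)
    (haut : ∀ (φ : W.Aut) (v : V), τ ((φ : W.graph ≃g W.graph) v) = τ v) :
    Nonempty (W.Aut ≃* ((t : T) → (W.induce {v | τ v = t}).Aut)) := by
  let F : W.Aut →* ((t : T) → (W.induce {v | τ v = t}).Aut) :=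
    MonoidHom.pi fun t => W.restrictAut {v | τ v = t} fun φ v => by simp [haut]
  refine ⟨MulEquiv.ofBijective F ⟨fun φ ψ h => aut_ext fun v => ?_, fun ψ => ?_⟩⟩
  · have := congrArg (fun f => ((f (τ v)).1 ⟨v, rfl⟩ : V)) h
    exact this
  · let σ : Equiv.Perm V := (Equiv.sigmaFiberEquiv τ).permCongr
      (Equiv.sigmaCongrRight fun t => (ψ t).1.toEquiv)
    have hσ : ∀ t (v : {v | τ v = t}), σ v = (ψ t).1 v := by
      rintro _ ⟨v, rfl⟩
      rfl
    have hτ : ∀ v, τ (σ v) = τ v := fun v => by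
      rw [hσ (τ v) ⟨v, rfl⟩]
      exact ((ψ (τ v)).1 ⟨v, rfl⟩).2
    refine ⟨W.autOfPerm σ (fun v w => ?_) (fun v => ?_), ?_⟩
    · by_cases hvw : τ v = τ w
      · rw [hσ (τ v) ⟨v, rfl⟩, hσ (τ v) ⟨w, hvw.symm⟩]
        exact aut_adj (ψ (τ v)) ⟨v, rfl⟩ ⟨w, hvw.symm⟩
      · refine iff_of_false (fun h => hvw ?_) (fun h => hvw (hadj _ _ h))
        simpa [hτ] using hadj _ _ h
    · rw [hσ (τ v) ⟨v, rfl⟩]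
      exact aut_weight (ψ (τ v)) ⟨v, rfl⟩
    · funext t
      exact aut_ext fun v => Subtype.ext (hσ t v)

/-- The disjoint union of `n` copies of a weighted graph. -/
def copies (n : ℕ) (W : WeightedGraph V) : WeightedGraph (Fin n × V) where
  graph :=
    { Adj := fun x y => x.1 = y.1 ∧ W.graph.Adj x.2 y.2
      symm := ⟨fun _ _ h => ⟨h.1.symm, h.2.symm⟩⟩
      loopless := ⟨fun _ h => W.graph.loopless.irrefl _ h.2⟩ }
  weight x := W.weight x.2

/-- The action of the wreath product on the disjoint union of copies. -/
def wreathToAut (n : ℕ) (W : WeightedGraph V) : WreathSym W.Aut n →* (copies n W).Aut where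
  toFun g := (copies n W).autOfPerm
    -- The left factor is read at the target index: `mulAutArrow` precomposes with the inverse
    -- permutation, and this makes the action multiplicative.
    { toFun := fun x => (g.right x.1, (g.left (g.right x.1)).1 x.2)
      invFun := fun x => (g.right⁻¹ x.1, ((g.left x.1)⁻¹).1 x.2)
      left_inv := fun x => by simp
      right_inv := fun x => by simp }
    (fun v w => by
      change _ ∧ _ ↔ _ ∧ _
      refine ⟨fun h => ?_, fun h => ?_⟩
      · have h1 : v.1 = w.1 := g.right.injective h.1
        refine ⟨h1, ?_⟩
        have h2 := h.2
        simp only [Equiv.coe_fn_mk, h1] at h2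
        exact (aut_adj _ _ _).1 h2
      · have h1 : v.1 = w.1 := h.1
        simp only [Equiv.coe_fn_mk, h1, true_and]
        exact (aut_adj _ _ _).2 h.2)
    (fun v => aut_weight _ _)
  map_one' := aut_ext fun _ => rfl
  map_mul' g h := aut_ext fun x => by
    refine Prod.ext rfl ?_
    simp only [SemidirectProduct.mul_left, SemidirectProduct.mul_right]
    change _ = (g.left (g.right (h.right x.1))).1 ((h.left (h.right x.1)).1 x.2)
    change (g.left (g.right (h.right x.1))).1
      ((h.left (g.right⁻¹ (g.right (h.right x.1)))).1 x.2) = _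
    simp

theorem wreathToAut_apply (n : ℕ) (W : WeightedGraph V) (g : WreathSym W.Aut n) (x : Fin n × V) :
    (wreathToAut n W g).1 x = (g.right x.1, (g.left (g.right x.1)).1 x.2) := rfl

theorem wreathToAut_injective (n : ℕ) (W : WeightedGraph V) [Nonempty V] :
    Function.Injective (wreathToAut n W) := by
  intro g h hgh
  have key : ∀ x, (wreathToAut n W g).1 x = (wreathToAut n W h).1 x := fun x => by rw [hgh]
  simp only [wreathToAut_apply, Prod.mk.injEq] at key
  have hr : g.right = h.right := Equiv.ext fun k => (key (k, Classical.arbitrary V)).1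
  refine SemidirectProduct.ext (funext fun k => aut_ext fun v => ?_) hr
  have := (key (g.right⁻¹ k, v)).2
  rw [← hr] at this
  simpa using this

theorem wreathToAut_surjective (n : ℕ) (W : WeightedGraph V) (d : V)
    (hd : ∀ v, v ≠ d → W.graph.Adj d v) : Function.Surjective (wreathToAut n W) := by
  intro φ
  -- Every vertex of a copy is `d` or adjacent to `d`, so a copy cannot be split between two copies.
  have hfst : ∀ (φ : (copies n W).Aut) k v, (φ.1 (k, v)).1 = (φ.1 (k, d)).1 := by
    intro φ k v
    by_cases h : v = d
    · rw [h]
    · have : (copies n W).graph.Adj (k, d) (k, v) := ⟨rfl, hd v h⟩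
      exact ((aut_adj φ _ _).2 this).1.symm
  have hinv : ∀ (φ ψ : (copies n W).Aut), φ * ψ = 1 →
      ∀ k, (φ.1 ((ψ.1 (k, d)).1, d)).1 = k := by
    intro φ ψ h k
    rw [← hfst φ _ (ψ.1 (k, d)).2]
    change ((φ * ψ).1 (k, d)).1 = k
    rw [h]
    rfl
  have hcomp : ∀ (φ ψ : (copies n W).Aut), φ * ψ = 1 →
      ∀ k v, (φ.1 ((ψ.1 (k, d)).1, (ψ.1 (k, v)).2)).2 = v := by
    intro φ ψ h k v
    rw [← hfst ψ _ v]
    change ((φ * ψ).1 (k, v)).2 = v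
    rw [h]
    rfl
  let σ : Equiv.Perm (Fin n) :=
    { toFun := fun k => (φ.1 (k, d)).1
      invFun := fun k => (φ⁻¹.1 (k, d)).1
      left_inv := hinv φ⁻¹ φ (inv_mul_cancel φ)
      right_inv := hinv φ φ⁻¹ (mul_inv_cancel φ) }
  have hσ : ∀ k, σ ((φ⁻¹.1 (k, d)).1) = k := hinv φ φ⁻¹ (mul_inv_cancel φ)
  -- The `k`-th coordinate is `φ` on the copy that lands in copy `k`, in line with reading `left` at
  -- the target.
  let f : Fin n → W.Aut := fun k => W.autOfPerm
    { toFun := fun v => (φ.1 ((φ⁻¹.1 (k, d)).1, v)).2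
      invFun := fun v => (φ⁻¹.1 (k, v)).2
      left_inv := fun v => by
        have := hcomp φ⁻¹ φ (inv_mul_cancel φ) ((φ⁻¹.1 (k, d)).1) v
        rwa [show (φ.1 ((φ⁻¹.1 (k, d)).1, d)).1 = k from hσ k] at this
      right_inv := hcomp φ φ⁻¹ (mul_inv_cancel φ) k }
    (fun v w => by
      refine Iff.trans ⟨fun h => ⟨(hfst φ _ v).trans (hfst φ _ w).symm, h⟩, fun h => h.2⟩
        ((aut_adj φ ((φ⁻¹.1 (k, d)).1, v) ((φ⁻¹.1 (k, d)).1, w)).trans (and_iff_right rfl)))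
    (fun v => aut_weight φ ((φ⁻¹.1 (k, d)).1, v))
  refine ⟨⟨f, σ⟩, aut_ext fun x => ?_⟩
  rw [wreathToAut_apply]
  refine Prod.ext (hfst φ x.1 x.2).symm ?_
  change (φ.1 ((φ⁻¹.1 (σ x.1, d)).1, x.2)).2 = _
  rw [show (φ⁻¹.1 (σ x.1, d)).1 = x.1 from hinv φ⁻¹ φ (inv_mul_cancel φ) x.1]

/-- A weighted graph with a dominating vertex: `n` disjoint copies of it have the wreath product
with `S_n` as automorphism group. -/
theorem nonempty_wreath_mulEquiv_aut_copies (n : ℕ) (W : WeightedGraph V) (d : V)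
    (hd : ∀ v, v ≠ d → W.graph.Adj d v) :
    Nonempty (WreathSym W.Aut n ≃* (copies n W).Aut) :=
  haveI : Nonempty V := ⟨d⟩
  ⟨MulEquiv.ofBijective (wreathToAut n W)
    ⟨wreathToAut_injective n W, wreathToAut_surjective n W d hd⟩⟩

/-- Automorphisms map components with a dominating vertex into components. -/
theorem aut_map_component (W : WeightedGraph V) {I : Type*} (c : V → I)
    (hadj : ∀ v w, W.graph.Adj v w → c v = c w)
    (hdom : ∀ v, ∃ d, c d = c v ∧ ∀ w, c w = c v → w ≠ d → W.graph.Adj d w)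
    (φ : W.Aut) {v w : V} (hvw : c v = c w) : c (φ.1 v) = c (φ.1 w) := by
  obtain ⟨d, hdv, hd⟩ := hdom v
  have aux : ∀ w, c w = c v → c (φ.1 w) = c (φ.1 d) := by
    intro w hw
    by_cases h : w = d
    · rw [h]
    · exact (hadj _ _ ((aut_adj φ _ _).2 (hd w hw h))).symm
  rw [aux v rfl, aux w hvw.symm]

/-- If the components are permuted transitively by automorphisms, the automorphism group is the
wreath product of that of one component with a symmetric group. -/
theorem nonempty_aut_mulEquiv_wreath (W : WeightedGraph V) {I : Type*} (c : V → I)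
    (hadj : ∀ v w, W.graph.Adj v w → c v = c w)
    (hdom : ∀ v, ∃ d, c d = c v ∧ ∀ w, c w = c v → w ≠ d → W.graph.Adj d w)
    (htrans : ∀ v w, ∃ φ : W.Aut, c (φ.1 v) = c w) (b : V) (n : ℕ)
    (hn : Nonempty (Fin n ≃ Set.range c)) :
    Nonempty (W.Aut ≃* WreathSym (W.induce {v | c v = c b}).Aut n) := by
  obtain ⟨e⟩ := hn
  have hmap := fun φ v w => W.aut_map_component c hadj hdom φ (v := v) (w := w)
  have hθ : ∀ k, ∃ φ : W.Aut, c (φ.1 b) = (e k : I) := by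
    intro k
    obtain ⟨w, hw⟩ := (e k).2
    obtain ⟨φ, hφ⟩ := htrans b w
    exact ⟨φ, hφ.trans hw⟩
  choose θ hθ using hθ
  have hθc : ∀ k v, c v = c b → c ((θ k).1 v) = (e k : I) := fun k v hv =>
    (hmap _ _ _ hv).trans (hθ k)
  let k' : V → Fin n := fun v => e.symm ⟨c v, v, rfl⟩
  have hk' : ∀ v, (e (k' v) : I) = c v := fun v => by simp [k']
  have hback : ∀ v, c ((θ (k' v))⁻¹.1 v) = c b := by
    intro v
    have := hmap (θ (k' v))⁻¹ v ((θ (k' v)).1 b) (by rw [hθ, hk'])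
    rwa [aut_inv_apply_self] at this
  have hk2 : ∀ k v, c v = c b → k' ((θ k).1 v) = k := by
    intro k v hv
    apply e.injective
    apply Subtype.ext
    rw [hk', hθc k v hv]
  -- The chosen automorphisms `θ k` transport the component of `b` onto every other one, exhibiting
  -- `W` as `n` copies of it.
  let Ξ : Fin n × {v | c v = c b} ≃ V :=
    { toFun := fun x => (θ x.1).1 x.2
      invFun := fun v => (k' v, ⟨(θ (k' v))⁻¹.1 v, hback v⟩)
      left_inv := by
        rintro ⟨k, v, hv⟩
        have := hk2 k v hv
        refine Prod.ext this (Subtype.ext ?_)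
        change (θ (k' ((θ k).1 v)))⁻¹.1 ((θ k).1 v) = v
        rw [this, aut_inv_apply_self]
      right_inv := fun v => aut_apply_inv_self _ _ }
  obtain ⟨d, hdb, hd⟩ := hdom b
  obtain ⟨E⟩ := nonempty_wreath_mulEquiv_aut_copies n (W.induce {v | c v = c b}) ⟨d, hdb⟩
    (fun v hv => hd v v.2 fun h => hv (Subtype.ext h))
  refine ⟨(E.trans (autCongr Ξ ?_ ?_)).symm⟩
  · rintro ⟨k, v, hv⟩ ⟨l, w, hw⟩
    change W.graph.Adj ((θ k).1 v) ((θ l).1 w) ↔ k = l ∧ W.graph.Adj v w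
    constructor
    · intro h
      have h1 := hadj _ _ h
      rw [hθc k v hv, hθc l w hw] at h1
      obtain rfl := e.injective (Subtype.ext h1)
      exact ⟨rfl, (aut_adj _ _ _).1 h⟩
    · rintro ⟨rfl, h⟩
      exact (aut_adj _ _ _).2 h
  · rintro ⟨k, v, hv⟩
    exact aut_weight _ _

/-- The structure of the automorphism group of a weighted graph whose components have dominating
vertices, in terms of the types of the components. -/
theorem nonempty_aut_mulEquiv_pi_wreath (W : WeightedGraph V) {I T : Type*} (c : V → I) (τ : V → T)
    (hadj : ∀ v w, W.graph.Adj v w → c v = c w)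
    (hdom : ∀ v, ∃ d, c d = c v ∧ ∀ w, c w = c v → w ≠ d → W.graph.Adj d w)
    (hτc : ∀ v w, c v = c w → τ v = τ w)
    (haut : ∀ (φ : W.Aut) v, τ (φ.1 v) = τ v)
    (htrans : ∀ v w, τ v = τ w → ∃ φ : W.Aut, c (φ.1 v) = c w)
    (b : T → V) (hb : ∀ t, τ (b t) = t) (n : T → ℕ)
    (hn : ∀ t, Nonempty (Fin (n t) ≃ c '' {v | τ v = t})) :
    Nonempty (W.Aut ≃* ((t : T) → WreathSym (W.induce {v | c v = c (b t)}).Aut (n t))) := by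
  obtain ⟨E⟩ := W.nonempty_aut_mulEquiv_pi τ (fun v w h => hτc _ _ (hadj _ _ h)) haut
  have key : ∀ t, Nonempty ((W.induce {v | τ v = t}).Aut ≃*
      WreathSym (W.induce {v | c v = c (b t)}).Aut (n t)) := by
    intro t
    obtain ⟨F⟩ := (W.induce {v | τ v = t}).nonempty_aut_mulEquiv_wreath (fun v => c v)
      (fun v w h => hadj _ _ h)
      (fun v => by
        obtain ⟨d, hdv, hd⟩ := hdom v
        exact ⟨⟨d, (hτc _ _ hdv).trans v.2⟩, hdv,
          fun w hw hwd => hd w hw fun h => hwd (Subtype.ext h)⟩)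
      (fun v w => by
        obtain ⟨φ, hφ⟩ := htrans v w (v.2.trans w.2.symm)
        exact ⟨W.restrictAut {v | τ v = t} (fun φ v => by simp [haut]) φ, hφ⟩)
      ⟨b t, hb t⟩ (n t) (by
        obtain ⟨e⟩ := hn t
        refine ⟨e.trans (Equiv.setCongr ?_)⟩
        ext i
        simp)
    let A : ((W.induce {v | τ v = t}).induce {v | c v = c (b t)}).Aut ≃*
        (W.induce {v | c v = c (b t)}).Aut := autCongr
      { toFun := fun v => ⟨v.1.1, v.2⟩
        invFun := fun v => ⟨⟨v.1, (hτc _ _ v.2).trans (hb t)⟩, v.2⟩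
        left_inv := fun _ => rfl
        right_inv := fun _ => rfl } (fun _ _ => Iff.rfl) (fun _ => rfl)
    refine ⟨F.trans (SemidirectProduct.congr (MulEquiv.piCongrRight fun _ => A)
      (MulEquiv.refl _) ?_)⟩
    intro σ
    rfl
  exact ⟨E.trans (MulEquiv.piCongrRight fun t => (key t).some)⟩

/-- Deleting a dominating vertex fixed by all automorphisms does not change the automorphism
group. -/
theorem nonempty_aut_mulEquiv_aut_compl (W : WeightedGraph V) (d : V)
    (hd : ∀ v, v ≠ d → W.graph.Adj d v) (huniq : ∀ d', (∀ v, v ≠ d' → W.graph.Adj d' v) → d' = d) :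
    Nonempty (W.Aut ≃* (W.induce {v | v ≠ d}).Aut) := by
  classical
  have hfix : ∀ φ : W.Aut, φ.1 d = d := by
    refine fun φ => huniq _ fun v hv => ?_
    rw [← aut_apply_inv_self φ v, aut_adj]
    refine hd _ fun h => hv ?_
    rw [← h, aut_apply_inv_self]
  have hinj : ∀ (φ : W.Aut) v, φ.1 v = d ↔ v = d := fun φ v =>
    ⟨fun h => φ.1.injective (h.trans (hfix φ).symm), fun h => by rw [h, hfix]⟩
  refine ⟨MulEquiv.ofBijective (W.restrictAut {v | v ≠ d} fun φ v => by simp [hinj])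
    ⟨fun φ ψ h => aut_ext fun v => ?_, fun ψ => ?_⟩⟩
  · by_cases hv : v = d
    · rw [hv, hfix, hfix]
    · exact congrArg (fun f => (f.1 ⟨v, hv⟩ : V)) h
  · let ψ' : Equiv.Perm {v // v ≠ d} := ψ.1.toEquiv
    let σ : Equiv.Perm V := Equiv.Perm.ofSubtype ψ'
    have hσd : σ d = d := Equiv.Perm.ofSubtype_apply_of_not_mem _ (by simp)
    have hσ : ∀ v (hv : v ≠ d), σ v = ψ.1 ⟨v, hv⟩ := fun v hv =>
      Equiv.Perm.ofSubtype_apply_of_mem ψ' hv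
    have hσne : ∀ v, v ≠ d → σ v ≠ d := fun v hv => by
      rw [hσ v hv]
      exact (ψ.1 ⟨v, hv⟩).2
    refine ⟨W.autOfPerm σ (fun v w => ?_) (fun v => ?_), aut_ext fun v => Subtype.ext (hσ v v.2)⟩
    · by_cases hv : v = d
      · subst hv
        by_cases hw : w = v
        · subst hw
          simp
        · rw [hσd]
          exact iff_of_true (hd _ (hσne w hw)) (hd w hw)
      · by_cases hw : w = d
        · subst hw
          rw [hσd]
          exact iff_of_true (hd _ (hσne v hv)).symm (hd v hv).symm
        · rw [hσ v hv, hσ w hw]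
          exact aut_adj ψ ⟨v, hv⟩ ⟨w, hw⟩
    · by_cases hv : v = d
      · rw [hv, hσd]
      · rw [hσ v hv]
        exact aut_weight ψ ⟨v, hv⟩

/-- Two weighted graphs that become isomorphic after deleting at most one dominating vertex from
each have isomorphic automorphism groups. -/
theorem nonempty_aut_mulEquiv_of_embedding (W : WeightedGraph V) (W' : WeightedGraph V')
    (j : V → V') (hj : Function.Injective j)
    (hadj : ∀ v w, W'.graph.Adj (j v) (j w) ↔ W.graph.Adj v w) (d : V')
    (hcover : ∀ v', v' ≠ d → ∃ v, j v = v') (hw : ∀ v, j v ≠ d → W'.weight (j v) = W.weight v)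
    (hd : ∀ v, v ≠ d → W'.graph.Adj d v)
    (huniq : ∀ d', (∀ v, v ≠ d' → W'.graph.Adj d' v) → d' = d) :
    Nonempty (W.Aut ≃* W'.Aut) := by
  obtain ⟨E⟩ := W'.nonempty_aut_mulEquiv_aut_compl d hd huniq
  -- If `d` is hit, its preimage is the unique dominating vertex of `W` and both are deleted;
  -- otherwise only `d` is. The weights at `d` are never compared.
  by_cases hmem : ∃ v, j v = d
  · obtain ⟨v₀, rfl⟩ := hmem
    obtain ⟨F⟩ := W.nonempty_aut_mulEquiv_aut_compl v₀
      (fun v hv => (hadj _ _).1 (hd _ (hj.ne hv)))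
      (fun d' hd' => hj (huniq _ fun v' hv' => by
        have : ∃ v, j v = v' := by
          by_cases h : v' = j v₀
          · exact ⟨v₀, h.symm⟩
          · exact hcover v' h
        obtain ⟨v, rfl⟩ := this
        exact (hadj _ _).2 (hd' v fun h => hv' (h ▸ rfl))))
    let e : {v | v ≠ v₀} ≃ {v' | v' ≠ j v₀} := Equiv.ofBijective
      (fun v => ⟨j v, hj.ne v.2⟩)
      ⟨fun v w h => Subtype.ext (hj (congrArg Subtype.val h)), fun v' => by
        obtain ⟨v, hv⟩ := hcover v'.1 v'.2
        exact ⟨⟨v, fun h => v'.2 (by rw [← hv, h])⟩, Subtype.ext hv⟩⟩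
    exact ⟨(F.trans (autCongr e (fun v w => hadj _ _) (fun v => hw _ (hj.ne v.2)))).trans E.symm⟩
  · push Not at hmem
    let e : V ≃ {v' | v' ≠ d} := Equiv.ofBijective (fun v => ⟨j v, hmem v⟩)
      ⟨fun v w h => hj (congrArg Subtype.val h), fun v' => by
        obtain ⟨v, hv⟩ := hcover v'.1 v'.2
        exact ⟨v, Subtype.ext hv⟩⟩
    exact ⟨(autCongr e (fun v w => hadj _ _) (fun v => hw _ (hmem v))).trans E.symm⟩

end WeightedGraph

/-! ### The graph of classes with equal closed neighborhoods -/

section Bar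

variable {V : Type u} {L : SimpleGraph V}

theorem mem_closedNeighborSet {a b : V} : b ∈ closedNeighborSet L a ↔ L.Adj a b ∨ b = a := Iff.rfl

theorem self_mem_closedNeighborSet (a : V) : a ∈ closedNeighborSet L a := Or.inr rfl

theorem mem_closedNeighborSet_comm {a b : V} :
    b ∈ closedNeighborSet L a ↔ a ∈ closedNeighborSet L b := by
  rw [mem_closedNeighborSet, mem_closedNeighborSet, L.adj_comm, eq_comm]

theorem mk_menSetoid_eq_iff {a b : V} : Quotient.mk (menSetoid L) a = Quotient.mk (menSetoid L) b ↔
    closedNeighborSet L a = closedNeighborSet L b :=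
  Quotient.eq

theorem bar_adj_mk {a b : V} :
    (bar L).graph.Adj (Quotient.mk _ a) (Quotient.mk _ b) ↔
      Quotient.mk (menSetoid L) a ≠ Quotient.mk (menSetoid L) b ∧ L.Adj a b := by
  have key : ∀ a b a' b' : V, Quotient.mk (menSetoid L) a' = Quotient.mk (menSetoid L) a →
      Quotient.mk (menSetoid L) b' = Quotient.mk (menSetoid L) b →
      Quotient.mk (menSetoid L) a ≠ Quotient.mk (menSetoid L) b → L.Adj a' b' → L.Adj a b := by
    intro a b a' b' ha hb hab h
    rw [mk_menSetoid_eq_iff] at ha hb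
    have h1 : b' ∈ closedNeighborSet L a := ha ▸ Or.inl h
    rw [mem_closedNeighborSet_comm, hb, mem_closedNeighborSet] at h1
    rcases h1 with h1 | rfl
    · exact h1.symm
    · exact absurd rfl hab
  constructor
  · rintro ⟨hab, ⟨a', b', ha, hb, h⟩ | ⟨b', a', hb, ha, h⟩⟩
    · exact ⟨hab, key _ _ _ _ ha hb hab h⟩
    · exact ⟨hab, key _ _ _ _ ha hb hab h.symm⟩
  · rintro ⟨hab, h⟩
    exact ⟨hab, Or.inl ⟨a, b, rfl, rfl, h⟩⟩

theorem mk_menSetoid_apply_eq_iff (e : L ≃g L) {a b : V} :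
    Quotient.mk (menSetoid L) (e a) = Quotient.mk (menSetoid L) (e b) ↔
      Quotient.mk (menSetoid L) a = Quotient.mk (menSetoid L) b := by
  have h : ∀ a c, e c ∈ closedNeighborSet L (e a) ↔ c ∈ closedNeighborSet L a := fun a c => by
    rw [mem_closedNeighborSet, mem_closedNeighborSet, e.map_adj_iff, EmbeddingLike.apply_eq_iff_eq]
  simp only [mk_menSetoid_eq_iff, Set.ext_iff]
  constructor
  · intro H c
    rw [← h a c, ← h b c]
    exact H (e c)
  · intro H c
    obtain ⟨c, rfl⟩ := e.surjective c
    rw [h, h]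
    exact H c

/-- An automorphism of a graph induces one of the weighted graph of classes. -/
theorem exists_bar_aut (e : L ≃g L) : ∃ φ : (bar L).Aut, ∀ a, φ.1 (Quotient.mk _ a) =
    Quotient.mk _ (e a) := by
  let σ : Equiv.Perm (Quotient (menSetoid L)) := Quotient.congr e.toEquiv fun a b => by
    rw [← Quotient.eq, ← Quotient.eq]
    exact (mk_menSetoid_apply_eq_iff e).symm
  refine ⟨(bar L).autOfPerm σ (fun A B => ?_) (fun A => ?_), fun _ => rfl⟩
  · induction A using Quotient.inductionOn with | _ a
    induction B using Quotient.inductionOn with | _ b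
    change (bar L).graph.Adj (Quotient.mk _ (e a)) (Quotient.mk _ (e b)) ↔ _
    rw [bar_adj_mk, bar_adj_mk, e.map_adj_iff, Ne, mk_menSetoid_apply_eq_iff]
  · induction A using Quotient.inductionOn with | _ a
    change Set.ncard {x : V | Quotient.mk (menSetoid L) x = Quotient.mk _ (e a)} =
      Set.ncard {x : V | Quotient.mk (menSetoid L) x = Quotient.mk _ a}
    rw [← Set.ncard_image_of_injective {x : V | Quotient.mk (menSetoid L) x = Quotient.mk _ a}
      e.injective]
    congr 1
    ext x
    obtain ⟨x, rfl⟩ := e.surjective x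
    simp [mk_menSetoid_apply_eq_iff]

/-- An automorphism of the weighted graph of classes lifts to a permutation of the vertices. -/
theorem exists_perm_of_bar_aut [Finite V] (φ : (bar L).Aut) :
    ∃ σ : Equiv.Perm V, ∀ a, Quotient.mk (menSetoid L) (σ a) = φ.1 (Quotient.mk _ a) := by
  -- Preservation of weights makes a class and its image equinumerous; arbitrary bijections between
  -- them are then glued.
  have key : ∀ A : Quotient (menSetoid L), Nonempty
      ({x : V // Quotient.mk (menSetoid L) x = A} ≃
        {x : V // Quotient.mk (menSetoid L) x = φ.1 A}) := by
    intro A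
    refine Finite.card_eq.mp ?_
    exact (WeightedGraph.aut_weight φ A).symm
  let π := Equiv.sigmaFiberEquiv (Quotient.mk (menSetoid L))
  refine ⟨π.symm.trans ((Equiv.sigmaCongr φ.1.toEquiv fun A => (key A).some).trans π),
    fun a => ?_⟩
  exact ((key (Quotient.mk _ a)).some ⟨a, rfl⟩).2

/-- Removing from a component `C` a nonempty set of vertices that are adjacent to all others in `C`
does not change the automorphism group of the weighted graph of classes. -/
theorem nonempty_bar_induce_aut_mulEquiv (L : SimpleGraph V) (C S : Set V)
    (B : Set (Quotient (menSetoid L))) (hB : ∀ y, Quotient.mk _ y ∈ B ↔ y ∈ C) (hSC : S ⊆ C)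
    (hC : ∀ y z, L.Adj y z → y ∈ C → z ∈ C)
    (hK : ∀ k, k ∈ C → k ∉ S → ∀ y ∈ C, y ≠ k → L.Adj k y) (x : V) (hxC : x ∈ C) (hxS : x ∉ S) :
    Nonempty ((bar (L.induce S)).Aut ≃* ((bar L).induce B).Aut) := by
  have hNC : ∀ y ∈ C, closedNeighborSet L y ⊆ C := by
    rintro y hy z (h | rfl)
    · exact hC _ _ h hy
    · exact hy
  have hNK : ∀ k ∈ C, k ∉ S → closedNeighborSet L k = C := by
    intro k hk hkS
    refine Set.Subset.antisymm (hNC k hk) fun y hy => ?_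
    by_cases h : y = k
    · exact Or.inr h
    · exact Or.inl (hK k hk hkS y hy h)
  have hNS : ∀ y z : S, z ∈ closedNeighborSet (L.induce S) y ↔
      (z : V) ∈ closedNeighborSet L (y : V) := by
    intro y z
    simp [mem_closedNeighborSet, Subtype.ext_iff]
  have hmk : ∀ y z : S, Quotient.mk (menSetoid (L.induce S)) y = Quotient.mk _ z ↔
      Quotient.mk (menSetoid L) (y : V) = Quotient.mk _ (z : V) := by
    intro y z
    rw [mk_menSetoid_eq_iff, mk_menSetoid_eq_iff]
    constructor
    · intro h
      ext w
      by_cases hwC : w ∈ C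
      · by_cases hwS : w ∈ S
        · rw [← hNS y ⟨w, hwS⟩, ← hNS z ⟨w, hwS⟩, h]
        -- A deleted vertex sees all of `C`, so it cannot distinguish `y` from `z`: deletion merges
        -- no classes.
        · rw [mem_closedNeighborSet_comm, hNK w hwC hwS, mem_closedNeighborSet_comm,
            hNK w hwC hwS]
          exact iff_of_true (hSC y.2) (hSC z.2)
      · exact iff_of_false (fun h => hwC (hNC _ (hSC y.2) h)) fun h => hwC (hNC _ (hSC z.2) h)
    · intro h
      ext w
      rw [hNS, hNS, h]
  let j : Quotient (menSetoid (L.induce S)) → B :=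
    Quotient.lift (fun y => ⟨Quotient.mk _ (y : V), (hB _).2 (hSC y.2)⟩)
      fun y z h => Subtype.ext ((hmk y z).1 (Quotient.sound h))
  have hj : Function.Injective j := by
    intro Y Z
    induction Y using Quotient.inductionOn with | _ y
    induction Z using Quotient.inductionOn with | _ z
    intro h
    exact (hmk y z).2 (congrArg Subtype.val h)
  refine WeightedGraph.nonempty_aut_mulEquiv_of_embedding _ _ j hj ?_
    ⟨Quotient.mk _ x, (hB x).2 hxC⟩ ?_ ?_ ?_ ?_
  · intro Y Z
    induction Y using Quotient.inductionOn with | _ y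
    induction Z using Quotient.inductionOn with | _ z
    change (bar L).graph.Adj (Quotient.mk _ (y : V)) (Quotient.mk _ (z : V)) ↔ _
    rw [bar_adj_mk, bar_adj_mk, Ne, Ne, hmk]
    rfl
  · rintro ⟨Y, hY⟩ hne
    induction Y using Quotient.inductionOn with | _ y
    have hyC := (hB y).1 hY
    by_cases hyS : y ∈ S
    · exact ⟨Quotient.mk _ ⟨y, hyS⟩, rfl⟩
    · refine absurd (Subtype.ext ?_) hne
      rw [mk_menSetoid_eq_iff, hNK y hyC hyS, hNK x hxC hxS]
  · intro Y hne
    induction Y using Quotient.inductionOn with | _ y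
    change Set.ncard {z : V | Quotient.mk (menSetoid L) z = Quotient.mk _ (y : V)} =
      Set.ncard {z : S | Quotient.mk (menSetoid (L.induce S)) z = Quotient.mk _ y}
    rw [← Set.ncard_image_of_injective _ Subtype.val_injective]
    congr 1
    ext z
    simp only [Set.mem_ofPred_eq, Set.mem_image, Subtype.exists, exists_and_right, exists_eq_right]
    constructor
    · intro h
      have hzC : z ∈ C := by
        refine hNC _ (hSC y.2) ?_
        rw [← mk_menSetoid_eq_iff.1 h]
        exact self_mem_closedNeighborSet z
      have hzS : z ∈ S := by
        by_contra hzS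
        refine hne (Subtype.ext ?_)
        change Quotient.mk (menSetoid L) (y : V) = _
        rw [← h, mk_menSetoid_eq_iff, hNK z hzC hzS, hNK x hxC hxS]
      exact ⟨hzS, (hmk ⟨z, hzS⟩ y).2 h⟩
    · rintro ⟨hzS, h⟩
      exact (hmk ⟨z, hzS⟩ y).1 h
  · rintro ⟨Y, hY⟩ hne
    induction Y using Quotient.inductionOn with | _ y
    refine bar_adj_mk.2 ⟨fun h => hne (Subtype.ext h.symm), hK x hxC hxS y ((hB y).1 hY) ?_⟩
    rintro rfl
    exact hne rfl
  · rintro ⟨Y, hY⟩ hdom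
    induction Y using Quotient.inductionOn with | _ y
    refine Subtype.ext ?_
    rw [mk_menSetoid_eq_iff, hNK x hxC hxS]
    refine Set.Subset.antisymm (hNC y ((hB y).1 hY)) fun z hz => ?_
    by_cases h : Quotient.mk (menSetoid L) z = Quotient.mk _ y
    · rw [← mk_menSetoid_eq_iff.1 h]
      exact self_mem_closedNeighborSet z
    · exact Or.inl (bar_adj_mk.1 (hdom ⟨Quotient.mk _ z, (hB z).2 hz⟩
        fun h' => h (congrArg Subtype.val h'))).2

end Bar

/-! ### Adjacency in the power graph through cyclic subgroups -/

section Adjacency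

variable {G : Type u} [Group G]

theorem powerGraph_adj [Finite G] {x y : {x : G // x ≠ 1}} : (powerGraph G).Adj x y ↔
    x ≠ y ∧ ((y : G) ∈ Subgroup.zpowers (x : G) ∨ (x : G) ∈ Subgroup.zpowers (y : G)) := by
  have key : ∀ x y : {x : G // x ≠ 1}, (∃ m : ℕ, 0 < m ∧ (y : G) = (x : G) ^ m) ↔
      (y : G) ∈ Subgroup.zpowers (x : G) := by
    intro x y
    constructor
    · rintro ⟨m, -, h⟩
      rw [h]
      exact Subgroup.npow_mem_zpowers _ _
    · intro h
      obtain ⟨m, hm⟩ := (mem_powers_iff_mem_zpowers.2 h : (y : G) ∈ Submonoid.powers (x : G))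
      refine ⟨m, Nat.pos_of_ne_zero ?_, hm.symm⟩
      rintro rfl
      exact y.2 (by simpa using hm.symm)
  change x ≠ y ∧ ((∃ m : ℕ, 0 < m ∧ (y : G) = (x : G) ^ m) ∨
    (∃ m : ℕ, 0 < m ∧ (x : G) = (y : G) ^ m)) ↔ _
  rw [key, key]

/-- A group automorphism induces an automorphism of the power graph. -/
def powerGraphIso [Finite G] (ψ : G ≃* G) : powerGraph G ≃g powerGraph G where
  toEquiv := ψ.toEquiv.subtypeEquiv fun x => by simp
  map_rel_iff' {x y} := by
    have key : ∀ x y : G, ψ y ∈ Subgroup.zpowers (ψ x) ↔ y ∈ Subgroup.zpowers x := by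
      intro x y
      simp only [Subgroup.mem_zpowers_iff, ← map_zpow, EmbeddingLike.apply_eq_iff_eq]
    rw [powerGraph_adj, powerGraph_adj, Ne, EmbeddingLike.apply_eq_iff_eq]
    exact and_congr Iff.rfl (or_congr (key _ _) (key _ _))

end Adjacency

/-! ### The unique subgroup of order `p` below an element -/

section Root

variable {G : Type u} [Group G] {p : ℕ}

/-- A power of `x` that has order `p` when `p` divides the order of `x`. -/
noncomputable def root (p : ℕ) (x : G) : G := x ^ (orderOf x / p)

theorem root_mem_zpowers (x : G) : root p x ∈ Subgroup.zpowers x := Subgroup.npow_mem_zpowers _ _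

theorem orderOf_root [Finite G] (hp : p.Prime) (hG : IsPGroup p G) {x : G} (hx : x ≠ 1) :
    orderOf (root p x) = p :=
  have := Fact.mk hp
  orderOf_pow_orderOf_div (orderOf_pos x).ne' (hG.dvd_orderOf hx)

/-- The elements of a cyclic group killed by `p` form a subgroup of order at most `p`, which any
element of order `p` must generate. -/
theorem zpowers_eq_of_orderOf_eq_prime [Finite G] (hp : p.Prime) {x a b : G} (ha : a ∈ Subgroup.zpowers x)
    (hb : b ∈ Subgroup.zpowers x) (hap : orderOf a = p) (hbp : orderOf b = p) :
    Subgroup.zpowers a = Subgroup.zpowers b := by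
  let _ : CommGroup (Subgroup.zpowers x) := IsCyclic.commGroup
  have key : ∀ c : Subgroup.zpowers x, orderOf c = p → Subgroup.zpowers c =
      (powMonoidHom p : Subgroup.zpowers x →* Subgroup.zpowers x).ker := by
    intro c hc
    refine Subgroup.eq_of_le_of_card_ge ?_ ?_
    · rw [Subgroup.zpowers_le, MonoidHom.mem_ker, powMonoidHom_apply, ← hc, pow_orderOf_eq_one]
    · rw [IsCyclic.card_powMonoidHom_ker, Nat.card_zpowers c, hc]
      exact Nat.le_of_dvd hp.pos (Nat.gcd_dvd_right _ _)
  have h := (key ⟨a, ha⟩ (by rw [Subgroup.orderOf_mk, hap])).trans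
    (key ⟨b, hb⟩ (by rw [Subgroup.orderOf_mk, hbp])).symm
  have h' := congrArg (Subgroup.map (Subgroup.zpowers x).subtype) h
  rwa [MonoidHom.map_zpowers, MonoidHom.map_zpowers] at h'

theorem zpowers_root_eq_iff [Finite G] (hp : p.Prime) (hG : IsPGroup p G) {x a : G} (hx : x ≠ 1)
    (ha : orderOf a = p) : Subgroup.zpowers (root p x) = Subgroup.zpowers a ↔
      a ∈ Subgroup.zpowers x := by
  constructor
  · intro h
    exact Subgroup.zpowers_le.2 (root_mem_zpowers x) (h ▸ Subgroup.mem_zpowers a)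
  · intro h
    exact zpowers_eq_of_orderOf_eq_prime hp (root_mem_zpowers x) h (orderOf_root hp hG hx) ha

theorem zpowers_root_eq_of_mem [Finite G] (hp : p.Prime) (hG : IsPGroup p G) {x y : G} (hx : x ≠ 1)
    (hy : y ≠ 1) (h : y ∈ Subgroup.zpowers x) :
    Subgroup.zpowers (root p x) = Subgroup.zpowers (root p y) :=
  (zpowers_root_eq_iff hp hG hx (orderOf_root hp hG hy)).2
    (Subgroup.zpowers_le.2 h (root_mem_zpowers y))

theorem zpowers_root_eq_of_adj [Finite G] (hp : p.Prime) (hG : IsPGroup p G) {x y : {x : G // x ≠ 1}}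
    (h : (powerGraph G).Adj x y) :
    Subgroup.zpowers (root p (x : G)) = Subgroup.zpowers (root p (y : G)) := by
  rcases (powerGraph_adj.1 h).2 with h | h
  · exact zpowers_root_eq_of_mem hp hG x.2 y.2 h
  · exact (zpowers_root_eq_of_mem hp hG y.2 x.2 h).symm

theorem zpowers_root_of_orderOf_eq (hp : p.Prime) {a : G} (ha : orderOf a = p) :
    Subgroup.zpowers (root p a) = Subgroup.zpowers a := by
  rw [root, ha, Nat.div_self hp.pos, pow_one]

theorem ne_one_of_orderOf_eq (hp : p.Prime) {a : G} (ha : orderOf a = p) : a ≠ 1 := by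
  rintro rfl
  exact hp.one_lt.ne (orderOf_one.symm.trans ha)

theorem orderOf_eq_of_pow_eq (hp : p.Prime) {k : ℕ} {x y : G} (hx : orderOf x = p)
    (h : y ^ p ^ k = x) : orderOf y = p ^ (k + 1) := by
  have := Fact.mk hp
  refine orderOf_eq_prime_pow ?_ ?_
  · rw [h]
    exact ne_one_of_orderOf_eq hp hx
  · rw [pow_succ, pow_mul, h, ← hx, pow_orderOf_eq_one]

theorem orderOf_eq_of_mem_zpowers (hp : p.Prime) {a b : G} (ha : orderOf a = p)
    (hb : b ∈ Subgroup.zpowers a) (hb1 : b ≠ 1) : orderOf b = p := by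
  have h : orderOf b ∣ p := ha ▸ orderOf_dvd_of_mem_zpowers hb
  rcases (Nat.dvd_prime hp).1 h with h | h
  · exact absurd (orderOf_eq_one_iff.1 h) hb1
  · exact h

end Root

/-! ### Transitivity of group automorphisms on elements of order `p` of one height -/

section Automorphism

variable {G : Type u} [CommGroup G] {p : ℕ}

/-- Bézout: `u` is a product of powers of `u ^ p` and `u ^ m`. -/
theorem mem_of_zpow_mem_of_pow_mem (hp : p.Prime) (M : Subgroup G) {u : G} {m : ℤ}
    (h : u ^ m ∈ M) (h' : u ^ p ∈ M) (hm : ¬ (p : ℤ) ∣ m) : u ∈ M := by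
  obtain ⟨r, s, hrs⟩ := (Nat.prime_iff_prime_int.1 hp).irreducible.coprime_iff_not_dvd.2 hm
  have : u = (u ^ p) ^ r * (u ^ m) ^ s := by
    rw [← zpow_natCast, ← zpow_mul, ← zpow_mul, ← zpow_add, mul_comm _ r, mul_comm m, hrs, zpow_one]
  rw [this]
  exact M.mul_mem (M.zpow_mem h' r) (M.zpow_mem h s)

/-- A cyclic subgroup generated by an element whose power of order `p` has the least possible
height has a supplement that avoids this power. -/
theorem exists_supplement [Finite G] (hp : p.Prime) (hG : IsPGroup p G) {h : ℕ} {x g : G}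
    (hx : orderOf x = p) (hg : g ^ p ^ h = x) (hn : ¬ ∃ u : G, u ^ p ^ (h + 1) = x) :
    ∃ K : Subgroup G, x ∉ K ∧ K ⊔ Subgroup.zpowers g = ⊤ := by
  -- `K` is maximal among subgroups that contain all `p ^ (h + 1)`-th powers and avoid `x`.
  obtain ⟨K, hK⟩ := (Set.toFinite {K : Subgroup G | (powMonoidHom (p ^ (h + 1)) : G →* G).range ≤ K
    ∧ x ∉ K}).exists_maximal ⟨_, le_refl _, fun hmem => hn (by simpa using hmem)⟩
  obtain ⟨hKr, hxK⟩ := hK.prop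
  refine ⟨K, hxK, ?_⟩
  set M := K ⊔ Subgroup.zpowers g with hM
  have hKM : K ≤ M := le_sup_left
  have hgM : g ∈ M := Subgroup.mem_sup_right (Subgroup.mem_zpowers g)
  have hxM : x ∈ M := hg ▸ M.pow_mem hgM _
  by_contra hne
  obtain ⟨u, huM, hup⟩ : ∃ u, u ∉ M ∧ u ^ p ∈ M := by
    obtain ⟨u, hu⟩ : ∃ u, u ∉ M := by
      by_contra! hall
      exact hne ((Subgroup.eq_top_iff' _).2 hall)
    have hex : ∃ k, u ^ p ^ k ∈ M := by
      obtain ⟨k, hk⟩ := isPGroup_iff_pow_pow_eq_one.1 hG u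
      exact ⟨k, hk ▸ M.one_mem⟩
    classical
    have hpos : Nat.find hex ≠ 0 := by
      intro h0
      have := Nat.find_spec hex
      rw [h0, pow_zero, pow_one] at this
      exact hu this
    obtain ⟨k, hk⟩ := Nat.exists_eq_succ_of_ne_zero hpos
    refine ⟨u ^ p ^ k, Nat.find_min hex (by omega), ?_⟩
    rw [← pow_mul, ← pow_succ]
    have := Nat.find_spec hex
    rwa [hk] at this
  obtain ⟨k, hk, z, hz, hkz⟩ := Subgroup.mem_sup.1 hup
  obtain ⟨a, rfl⟩ := Subgroup.mem_zpowers_iff.1 hz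
  -- Here `u ^ p = k * g ^ a`. If `p` divides `a`, correcting `u` by a power of `g` puts its `p`-th
  -- power in `K`, against maximality. If not, raising to the power `p ^ h` puts `x ^ a`, hence `x`,
  -- in `K`.
  by_cases hpa : (p : ℤ) ∣ a
  · obtain ⟨b, rfl⟩ := hpa
    have hu' : (u * g ^ (-b)) ^ p = k := by
      rw [mul_pow, ← hkz, ← zpow_natCast (g ^ (-b)), ← zpow_mul, mul_assoc, ← zpow_add]
      have : (p : ℤ) * b + -b * p = 0 := by ring
      rw [this, zpow_zero, mul_one]
    have hu'M : u * g ^ (-b) ∉ M := fun hmem => huM (by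
      simpa using M.mul_mem hmem (M.zpow_mem hgM b))
    generalize u * g ^ (-b) = w at hu' hu'M
    have hxw : x ∈ K ⊔ Subgroup.zpowers w := by
      by_contra hxw
      have := hK.le_of_ge (y := K ⊔ Subgroup.zpowers w) ⟨hKr.trans le_sup_left, hxw⟩ le_sup_left
      exact hu'M (hKM (this (Subgroup.mem_sup_right (Subgroup.mem_zpowers w))))
    obtain ⟨k₁, hk₁, z₁, hz₁, hkz₁⟩ := Subgroup.mem_sup.1 hxw
    obtain ⟨m, rfl⟩ := Subgroup.mem_zpowers_iff.1 hz₁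
    by_cases hpm : (p : ℤ) ∣ m
    · obtain ⟨c, rfl⟩ := hpm
      refine hxK (hkz₁ ▸ K.mul_mem hk₁ ?_)
      rw [zpow_mul, zpow_natCast, hu']
      exact K.zpow_mem hk c
    · refine hu'M (mem_of_zpow_mem_of_pow_mem hp M ?_ (hu' ▸ hKM hk) hpm)
      rw [← eq_inv_mul_iff_mul_eq] at hkz₁
      rw [hkz₁]
      exact M.mul_mem (M.inv_mem (hKM hk₁)) hxM
  · refine hxK (mem_of_zpow_mem_of_pow_mem hp K (m := a) ?_ ?_ hpa)
    · have h1 : u ^ p ^ (h + 1) ∈ K := hKr ⟨u, rfl⟩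
      rw [pow_succ', pow_mul, ← hkz, mul_pow, ← zpow_natCast (g ^ a), ← zpow_mul, mul_comm a,
        zpow_mul, zpow_natCast, hg] at h1
      exact (K.mul_mem_cancel_left (K.pow_mem hk _)).1 h1
    · rw [← hx, pow_orderOf_eq_one]
      exact K.one_mem

/-- A nontrivial common element would have `x` among its powers, as `⟨g⟩` has only one subgroup of
order `p`. -/
theorem disjoint_zpowers [Finite G] (hp : p.Prime) (hG : IsPGroup p G) {h : ℕ} {x g : G}
    (hx : orderOf x = p) (hg : g ^ p ^ h = x) {K : Subgroup G} (hxK : x ∉ K) :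
    Disjoint (Subgroup.zpowers g) K := by
  rw [Subgroup.disjoint_def]
  intro y hyg hyK
  by_contra hy
  have hg1 : g ≠ 1 := fun h => hy (by simpa [h] using hyg)
  have hxg : x ∈ Subgroup.zpowers g := hg ▸ Subgroup.npow_mem_zpowers g _
  have hxy := (zpowers_root_eq_iff hp hG hy hx).1
    ((zpowers_root_eq_of_mem hp hG hg1 hy hyg).symm.trans
      ((zpowers_root_eq_iff hp hG hg1 hx).2 hxg))
  exact hxK (Subgroup.zpowers_le.2 hyK hxy)

/-- The cardinality condition involves only `h` and `K`, so a complement found for one element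
serves every other whose power of order `p` avoids `K`. -/
theorem isComplement'_zpowers [Finite G] (hp : p.Prime) (hG : IsPGroup p G) {h : ℕ} {x g : G}
    (hx : orderOf x = p) (hg : g ^ p ^ h = x) {K : Subgroup G} (hxK : x ∉ K)
    (hcard : p ^ (h + 1) * Nat.card K = Nat.card G) :
    Subgroup.IsComplement' (Subgroup.zpowers g) K := by
  refine Subgroup.isComplement'_of_card_mul_and_disjoint ?_ ?_
  · rw [Nat.card_zpowers, orderOf_eq_of_pow_eq hp hx hg, hcard]
  · exact disjoint_zpowers hp hG hx hg hxK

/-- Keep the factor `K` and exchange the isomorphic cyclic factors. -/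
theorem exists_mulEquiv_of_isComplement' {g g' : G} {K : Subgroup G}
    (hg : Subgroup.IsComplement' (Subgroup.zpowers g) K)
    (hg' : Subgroup.IsComplement' (Subgroup.zpowers g') K) (ho : orderOf g = orderOf g') :
    ∃ ψ : G ≃* G, ψ g = g' := by
  have key : ∀ g : G, Subgroup.IsComplement' (Subgroup.zpowers g) K →
      ∃ E : Subgroup.zpowers g × K ≃* G, ∀ z, E z = z.1 * z.2 := fun g hg =>
    ⟨MulEquiv.ofBijective ((Subgroup.zpowers g).subtype.coprod K.subtype) hg, fun _ => rfl⟩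
  obtain ⟨E, hE⟩ := key g hg
  obtain ⟨E', hE'⟩ := key g' hg'
  have hgen : ∀ g : G, ∀ z : Subgroup.zpowers g,
      z ∈ Subgroup.zpowers (⟨g, Subgroup.mem_zpowers g⟩ : Subgroup.zpowers g) := by
    rintro g ⟨_, m, rfl⟩
    exact ⟨m, rfl⟩
  let e : Subgroup.zpowers g ≃* Subgroup.zpowers g' := mulEquivOfOrderOfEq (hgen g) (hgen g')
    (by rwa [Subgroup.orderOf_mk, Subgroup.orderOf_mk])
  refine ⟨E.symm.trans ((MulEquiv.prodCongr e (MulEquiv.refl K)).trans E'), ?_⟩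
  have h1 : E.symm g = (⟨g, Subgroup.mem_zpowers g⟩, 1) := by
    rw [MulEquiv.symm_apply_eq, hE]
    simp
  have h2 : e ⟨g, Subgroup.mem_zpowers g⟩ = ⟨g', Subgroup.mem_zpowers g'⟩ :=
    mulEquivOfOrderOfEq_apply_gen _ _ _
  simp [h1, hE', MulEquiv.prodCongr, h2]

/-- In a finite abelian `p`-group, the automorphism group is transitive on the elements of order `p`
of a given height. -/
theorem exists_mulEquiv_apply_eq [Finite G] (hp : p.Prime) (hG : IsPGroup p G) {h : ℕ} {x x' : G}
    (hx : orderOf x = p) (hx' : orderOf x' = p) (hpow : ∃ u : G, u ^ p ^ h = x)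
    (hpow' : ∃ u : G, u ^ p ^ h = x') (hn : ¬ ∃ u : G, u ^ p ^ (h + 1) = x)
    (hn' : ¬ ∃ u : G, u ^ p ^ (h + 1) = x') : ∃ ψ : G ≃* G, ψ x = x' := by
  have key : ∀ x g : G, orderOf x = p → g ^ p ^ h = x → (¬ ∃ u : G, u ^ p ^ (h + 1) = x) →
      ∃ K : Subgroup G, x ∉ K ∧ ∀ x' g' : G, orderOf x' = p → g' ^ p ^ h = x' → x' ∉ K →
        ∃ ψ : G ≃* G, ψ x = x' := by
    intro x g hx hg hn
    obtain ⟨K, hxK, hK⟩ := exists_supplement hp hG hx hg hn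
    have hc : Subgroup.IsComplement' (Subgroup.zpowers g) K :=
      Subgroup.isComplement'_of_disjoint_and_mul_eq_univ
      (disjoint_zpowers hp hG hx hg hxK) (by
        rw [← Subgroup.normal_mul, sup_comm, hK, Subgroup.coe_top])
    have hcard := hc.card_mul_card
    rw [Nat.card_zpowers, orderOf_eq_of_pow_eq hp hx hg] at hcard
    refine ⟨K, hxK, fun x' g' hx' hg' hxK' => ?_⟩
    obtain ⟨ψ, hψ⟩ := exists_mulEquiv_of_isComplement' hc
      (isComplement'_zpowers hp hG hx' hg' hxK' hcard)
      ((orderOf_eq_of_pow_eq hp hx hg).trans (orderOf_eq_of_pow_eq hp hx' hg').symm)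
    exact ⟨ψ, by rw [← hg, map_pow, hψ, hg']⟩
  obtain ⟨g, hg⟩ := hpow
  obtain ⟨g', hg'⟩ := hpow'
  obtain ⟨K, hxK, hK⟩ := key x g hx hg hn
  obtain ⟨K', hxK', hK'⟩ := key x' g' hx' hg' hn'
  by_cases h1 : x' ∈ K
  · by_cases h2 : x ∈ K'
    -- When each complement contains the other element, `x * x'` avoids both and serves as an
    -- intermediary.
    · have hxx : x * x' ∉ K := fun h => hxK ((K.mul_mem_cancel_right h1).1 h)
      have hxx' : x * x' ∉ K' := fun h => hxK' ((K'.mul_mem_cancel_left h2).1 h)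
      have ho : orderOf (x * x') = p := by
        have := Fact.mk hp
        refine orderOf_eq_prime ?_ fun h => hxx (h ▸ K.one_mem)
        have e1 : x ^ p = 1 := by rw [← hx, pow_orderOf_eq_one]
        have e2 : x' ^ p = 1 := by rw [← hx', pow_orderOf_eq_one]
        rw [mul_pow, e1, e2, one_mul]
      have hgg : (g * g') ^ p ^ h = x * x' := by rw [mul_pow, hg, hg']
      obtain ⟨ψ, hψ⟩ := hK _ _ ho hgg hxx
      obtain ⟨ψ', hψ'⟩ := hK' _ _ ho hgg hxx'
      exact ⟨ψ.trans ψ'.symm, by simp [hψ, ← hψ']⟩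
    · obtain ⟨ψ, hψ⟩ := hK' x g hx hg h2
      exact ⟨ψ.symm, by simp [← hψ]⟩
  · exact hK x' g' hx' hg' h1

end Automorphism

/-! ### Counting the elements above an element of order `p` -/

section Count

variable {G : Type u} [CommGroup G] {p : ℕ}

theorem ncard_zpowers_diff_one [Finite G] {a : G} (ha : orderOf a = p) :
    Set.ncard {b : G | b ∈ Subgroup.zpowers a ∧ b ≠ 1} = p - 1 := by
  have : {b : G | b ∈ Subgroup.zpowers a ∧ b ≠ 1} = (Subgroup.zpowers a : Set G) \ {1} := by
    ext b
    simp
  rw [this, Set.ncard_sdiff_singleton_of_mem (Subgroup.one_mem _)]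
  change Nat.card (Subgroup.zpowers a) - 1 = p - 1
  rw [Nat.card_zpowers, ha]

theorem exists_pow_eq_of_mem_zpowers {a b : G} {m : ℕ} (h : b ∈ Subgroup.zpowers a)
    (ha : ∃ u : G, u ^ m = a) : ∃ u : G, u ^ m = b :=
  Subgroup.zpowers_le.2 (show a ∈ (powMonoidHom m : G →* G).range from ha) h

theorem exists_pow_pow_eq_of_le {x : G} {k l : ℕ} (hkl : k ≤ l) (h : ∃ u : G, u ^ p ^ l = x) :
    ∃ u : G, u ^ p ^ k = x := by
  obtain ⟨u, rfl⟩ := h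
  exact ⟨u ^ p ^ (l - k), by rw [← pow_mul, ← pow_add, Nat.sub_add_cancel hkl]⟩

/-- A nonempty fiber of the power map is a coset of its kernel. -/
theorem ncard_pow_eq {b : G} {m : ℕ} (h : ∃ u : G, u ^ m = b) :
    Set.ncard {y : G | y ^ m = b} = Set.ncard {y : G | y ^ m = 1} := by
  obtain ⟨u, rfl⟩ := h
  rw [← Set.ncard_image_of_injective {y : G | y ^ m = 1} (mul_left_injective u)]
  congr 1
  ext y
  simp only [Set.mem_ofPred_eq, Set.mem_image]
  constructor
  · intro hy
    exact ⟨y * u⁻¹, by rw [mul_pow, hy, inv_pow, mul_inv_cancel], by simp⟩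
  · rintro ⟨z, hz, rfl⟩
    rw [mul_pow, hz, one_mul]

open Classical in
/-- The number of elements having a given element of order `p` among their powers. -/
theorem ncard_mem_zpowers [Finite G] (hp : p.Prime) {n : ℕ} (hcard : Nat.card G = p ^ n) {a : G}
    (ha : orderOf a = p) : Set.ncard {y : G | a ∈ Subgroup.zpowers y} =
      ∑ k ∈ Finset.range n, (p - 1) *
        if ∃ u : G, u ^ p ^ k = a then Set.ncard {y : G | y ^ p ^ k = 1} else 0 := by
  have := Fact.mk hp
  let _ := Fintype.ofFinite G
  have hG : IsPGroup p G := IsPGroup.of_card hcard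
  set Z : Finset G := Finset.univ.filter fun b => b ∈ Subgroup.zpowers a ∧ b ≠ 1 with hZ
  have hZcard : Z.card = p - 1 := by
    rw [← ncard_zpowers_diff_one ha, ← Set.ncard_coe_finset]
    simp [hZ]
  have hmemZ : ∀ b, b ∈ Z ↔ b ∈ Subgroup.zpowers a ∧ b ≠ 1 := fun b => by simp [hZ]
  have hZo : ∀ b ∈ Z, orderOf b = p := fun b hb =>
    orderOf_eq_of_mem_zpowers hp ha ((hmemZ b).1 hb).1 ((hmemZ b).1 hb).2
  have hZa : ∀ b ∈ Z, a ∈ Subgroup.zpowers b := fun b hb => by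
    rw [zpowers_eq_of_orderOf_eq_prime hp ((hmemZ b).1 hb).1 (Subgroup.mem_zpowers a) (hZo b hb) ha]
    exact Subgroup.mem_zpowers a
  -- An element `y` of order `p ^ (k + 1)` lies above `a` exactly when `y ^ p ^ k` generates `⟨a⟩`.
  -- The order determines `k`, so the pieces are disjoint.
  have hunion : {y : G | a ∈ Subgroup.zpowers y} = (((Finset.range n ×ˢ Z).biUnion
      fun x => Finset.univ.filter fun y : G => y ^ p ^ x.1 = x.2 : Finset G) : Set G) := by
    ext y
    simp only [Set.mem_ofPred_eq, Finset.coe_biUnion, Finset.mem_coe, Finset.mem_product,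
      Finset.mem_range, Finset.coe_filter, Finset.mem_univ, true_and, Set.mem_iUnion, Prod.exists,
      exists_prop]
    constructor
    · intro hy
      have hy1 : y ≠ 1 := by
        rintro rfl
        rw [Subgroup.zpowers_one_eq_bot, Subgroup.mem_bot] at hy
        exact ne_one_of_orderOf_eq hp ha hy
      obtain ⟨m, hm⟩ := IsPGroup.iff_orderOf.1 hG y
      obtain ⟨k, rfl⟩ : ∃ k, m = k + 1 := Nat.exists_eq_succ_of_ne_zero fun h0 => hy1 (by
        rwa [h0, pow_zero, orderOf_eq_one_iff] at hm)
      have hk : k < n := by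
        have h1 : p ^ (k + 1) ∣ p ^ n := by
          rw [← hm, ← hcard]
          exact orderOf_dvd_natCard y
        exact (Nat.pow_dvd_pow_iff_le_right hp.one_lt).1 h1
      have ho : orderOf (y ^ p ^ k) = p := by
        rw [orderOf_pow_of_dvd (pow_pos hp.pos k).ne' (hm ▸ pow_dvd_pow p k.le_succ), hm, pow_succ,
          Nat.mul_div_cancel_left _ (pow_pos hp.pos k)]
      refine ⟨k, y ^ p ^ k, ⟨hk, (hmemZ _).2 ⟨?_, ne_one_of_orderOf_eq hp ho⟩⟩, rfl⟩
      rw [← zpowers_eq_of_orderOf_eq_prime hp (Subgroup.npow_mem_zpowers y _) hy ho ha]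
      exact Subgroup.mem_zpowers _
    · rintro ⟨k, b, ⟨-, hb⟩, hyb⟩
      exact Subgroup.zpowers_le.2 (hyb ▸ Subgroup.npow_mem_zpowers y _) (hZa b hb)
  rw [hunion, Set.ncard_coe_finset, Finset.card_biUnion, Finset.sum_product]
  · refine Finset.sum_congr rfl fun k _ => ?_
    rw [← hZcard, ← smul_eq_mul, ← Finset.sum_const]
    refine Finset.sum_congr rfl fun b hb => ?_
    have hfib : (Finset.univ.filter fun y : G => y ^ p ^ k = b).card =
        Set.ncard {y : G | y ^ p ^ k = b} := by
      rw [← Set.ncard_coe_finset]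
      simp
    change (Finset.univ.filter fun y : G => y ^ p ^ k = b).card = _
    rw [hfib]
    split_ifs with h
    · exact ncard_pow_eq (exists_pow_eq_of_mem_zpowers ((hmemZ b).1 hb).1 h)
    · rw [Set.ncard_eq_zero, Set.eq_empty_iff_forall_notMem]
      exact fun y hy => h (exists_pow_eq_of_mem_zpowers (hZa b hb) ⟨y, hy⟩)
  · rintro ⟨k, b⟩ hkb ⟨l, c⟩ hlc hne
    rw [Function.onFun, Finset.disjoint_left]
    intro y hy hy'
    simp only [Finset.mem_filter, Finset.mem_univ, true_and] at hy hy'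
    have hb : b ∈ Z := (Finset.mem_product.1 hkb).2
    have hc : c ∈ Z := (Finset.mem_product.1 hlc).2
    have h1 := (orderOf_eq_of_pow_eq hp (hZo b hb) hy).symm.trans
      (orderOf_eq_of_pow_eq hp (hZo c hc) hy')
    have hkl : k = l := Nat.succ_injective (Nat.pow_right_injective hp.two_le h1)
    subst hkl
    exact hne (by rw [← hy, ← hy'])

/-- The number of elements above an element of order `p` strictly increases with its height. -/
theorem ncard_mem_zpowers_lt [Finite G] (hp : p.Prime) (hG : IsPGroup p G) {a a' : G}
    (ha : orderOf a = p) (ha' : orderOf a' = p) {h : ℕ} (hn : ¬ ∃ u : G, u ^ p ^ h = a)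
    (hpow : ∃ u : G, u ^ p ^ h = a') : Set.ncard {y : G | a ∈ Subgroup.zpowers y} <
      Set.ncard {y : G | a' ∈ Subgroup.zpowers y} := by
  classical
  have := Fact.mk hp
  obtain ⟨n, hcard⟩ := IsPGroup.iff_card.1 hG
  rw [ncard_mem_zpowers hp hcard ha, ncard_mem_zpowers hp hcard ha']
  have hp1 : 0 < p - 1 := Nat.sub_pos_of_lt hp.one_lt
  -- Greater height only adds terms to the sum; the term at `h` is present for `a'` and absent for
  -- `a`.
  refine Finset.sum_lt_sum (fun k _ => Nat.mul_le_mul_left _ ?_) ⟨h, ?_, ?_⟩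
  · by_cases hk : ∃ u : G, u ^ p ^ k = a
    · have hkh : k ≤ h := le_of_not_ge fun hhk => hn (exists_pow_pow_eq_of_le hhk hk)
      rw [if_pos hk, if_pos (exists_pow_pow_eq_of_le hkh hpow)]
    · rw [if_neg hk]
      exact Nat.zero_le _
  · rw [Finset.mem_range]
    obtain ⟨u, hu⟩ := hpow
    have h1 := orderOf_dvd_natCard u
    rw [orderOf_eq_of_pow_eq hp ha' hu, hcard] at h1
    exact (Nat.pow_dvd_pow_iff_le_right hp.one_lt).1 h1
  · rw [if_neg hn, if_pos hpow, mul_zero]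
    refine Nat.mul_pos hp1 ?_
    rw [Set.ncard_pos]
    exact ⟨1, one_pow _⟩

end Count

/-! ### Heights and the sets `H_t` -/

section Height

variable {G : Type u} [CommGroup G] {p : ℕ}

/-- The subgroups of `p ^ n`-th powers decrease with `n`, so two consecutive exponents decide the
height. -/
theorem mem_H_iff (hp : p.Prime) {t : ℕ} (ht : 1 ≤ t) {x : {x : G // x ≠ 1}} : x ∈ H p G t ↔
    orderOf (x : G) = p ∧ (∃ u : G, u ^ p ^ (t - 1) = x) ∧ ¬ ∃ u : G, u ^ p ^ t = x := by
  refine and_congr Iff.rfl ⟨?_, ?_⟩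
  · rintro ⟨⟨n, hn, hx⟩, hub⟩
    have hn' := Nat.pow_right_injective hp.two_le hn
    subst hn'
    refine ⟨hx, fun h => ?_⟩
    have := (Nat.pow_le_pow_iff_right hp.one_lt).1 (hub ⟨t, rfl, h⟩)
    omega
  · rintro ⟨hx, hn⟩
    refine ⟨⟨t - 1, rfl, hx⟩, ?_⟩
    rintro _ ⟨n, rfl, h⟩
    refine Nat.pow_le_pow_right hp.pos ?_
    by_contra hlt
    exact hn (exists_pow_pow_eq_of_le (by omega) h)

theorem eq_of_mem_H (hp : p.Prime) {s t : ℕ} (hs : 1 ≤ s) (ht : 1 ≤ t) {x : {x : G // x ≠ 1}}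
    (hxs : x ∈ H p G s) (hxt : x ∈ H p G t) : s = t := by
  have key : ∀ s t : ℕ, 1 ≤ s → 1 ≤ t → x ∈ H p G s → x ∈ H p G t → s ≤ t := by
    intro s t hs ht hxs hxt
    by_contra hlt
    exact ((mem_H_iff hp ht).1 hxt).2.2
      (exists_pow_pow_eq_of_le (by omega) ((mem_H_iff hp hs).1 hxs).2.1)
  exact le_antisymm (key s t hs ht hxs hxt) (key t s ht hs hxt hxs)

theorem exists_mem_H [Finite G] (hp : p.Prime) (hG : IsPGroup p G) {x : {x : G // x ≠ 1}}
    (hx : orderOf (x : G) = p) : ∃ t, 1 ≤ t ∧ x ∈ H p G t := by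
  classical
  have hex : ∃ t, ¬ ∃ u : G, u ^ p ^ t = x := by
    have := Fact.mk hp
    obtain ⟨n, hcard⟩ := IsPGroup.iff_card.1 hG
    refine ⟨n, ?_⟩
    rintro ⟨u, hu⟩
    rw [← hcard, pow_card_eq_one'] at hu
    exact x.2 hu.symm
  have hpos : 1 ≤ Nat.find hex := by
    rw [Nat.one_le_iff_ne_zero]
    intro h0
    have := Nat.find_spec hex
    rw [h0] at this
    exact this ⟨x, by simp⟩
  refine ⟨Nat.find hex, hpos, (mem_H_iff hp hpos).2 ⟨hx, ?_, Nat.find_spec hex⟩⟩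
  exact not_not.1 (Nat.find_min hex (by omega))

theorem mem_H_of_zpowers_eq (hp : p.Prime) {t : ℕ} (ht : 1 ≤ t) {x y : {x : G // x ≠ 1}}
    (h : Subgroup.zpowers (x : G) = Subgroup.zpowers (y : G)) (hx : x ∈ H p G t) :
    y ∈ H p G t := by
  rw [mem_H_iff hp ht] at hx ⊢
  have hxy : (x : G) ∈ Subgroup.zpowers (y : G) := h ▸ Subgroup.mem_zpowers (x : G)
  have hyx : (y : G) ∈ Subgroup.zpowers (x : G) := h ▸ Subgroup.mem_zpowers (y : G)
  refine ⟨?_, exists_pow_eq_of_mem_zpowers hyx hx.2.1,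
    fun hy => hx.2.2 (exists_pow_eq_of_mem_zpowers hxy hy)⟩
  rw [← Nat.card_zpowers, ← h, Nat.card_zpowers, hx.1]

/-- The number of elements of order `p` of a given height in terms of the subgroups that they
generate. -/
theorem ncard_H_eq [Finite G] (hp : p.Prime) {t : ℕ} (ht : 1 ≤ t) : (H p G t).ncard =
    Set.ncard ((fun x : {x : G // x ≠ 1} => Subgroup.zpowers (x : G)) '' H p G t) * (p - 1) := by
  classical
  have hfin : (H p G t).Finite := Set.toFinite _
  rw [Set.ncard_eq_toFinset_card _ hfin, Set.ncard_eq_toFinset_card _ (hfin.image _)]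
  have hmaps : ∀ x ∈ hfin.toFinset, Subgroup.zpowers (x : G) ∈ (hfin.image
      (fun x : {x : G // x ≠ 1} => Subgroup.zpowers (x : G))).toFinset := by
    intro x hx
    rw [Set.Finite.mem_toFinset] at hx ⊢
    exact Set.mem_image_of_mem _ hx
  rw [Finset.card_eq_sum_card_fiberwise hmaps, ← smul_eq_mul, ← Finset.sum_const]
  -- The fiber over a subgroup of order `p` is its set of generators, all of one height.
  refine Finset.sum_congr rfl fun C hC => ?_
  rw [Set.Finite.mem_toFinset] at hC
  obtain ⟨x, hx, rfl⟩ := hC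
  rw [← ncard_zpowers_diff_one hx.1, ← Set.ncard_coe_finset,
    ← Set.ncard_image_of_injective _ Subtype.val_injective]
  congr 1
  ext y
  simp only [Finset.coe_filter, Set.Finite.mem_toFinset, Set.mem_image, Set.mem_ofPred_eq,
    Subtype.exists, exists_and_right, exists_eq_right]
  constructor
  · rintro ⟨⟨hy, -⟩, h⟩
    exact ⟨h ▸ Subgroup.mem_zpowers y, hy⟩
  · rintro ⟨h, hy⟩
    have hyx : Subgroup.zpowers y = Subgroup.zpowers (x : G) :=
      zpowers_eq_of_orderOf_eq_prime hp h (Subgroup.mem_zpowers _)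
        (orderOf_eq_of_mem_zpowers hp hx.1 h hy) hx.1
    exact ⟨⟨hy, mem_H_of_zpowers_eq hp ht (y := ⟨y, hy⟩) hyx.symm hx⟩, hyx⟩

end Height

/-! ### Components of the power graph and their orbits -/

section Component

variable {G : Type u} [CommGroup G] {p : ℕ}

theorem zpowers_root_eq_of_closedNeighborSet_eq [Finite G] (hp : p.Prime) (hG : IsPGroup p G)
    {x y : {x : G // x ≠ 1}}
    (h : closedNeighborSet (powerGraph G) x = closedNeighborSet (powerGraph G) y) :
    Subgroup.zpowers (root p (x : G)) = Subgroup.zpowers (root p (y : G)) := by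
  have hxy : x ∈ closedNeighborSet (powerGraph G) y := h ▸ self_mem_closedNeighborSet x
  rcases hxy with hxy | rfl
  · exact (zpowers_root_eq_of_adj hp hG hxy).symm
  · rfl

/-- The subgroup of order `p` below the elements of a class. -/
noncomputable def component [Finite G] (hp : p.Prime) (hG : IsPGroup p G) :
    Quotient (menSetoid (powerGraph G)) → Subgroup G :=
  Quotient.lift (fun x => Subgroup.zpowers (root p (x : G))) fun _ _ h =>
    zpowers_root_eq_of_closedNeighborSet_eq hp hG h

@[simp]
theorem component_mk [Finite G] (hp : p.Prime) (hG : IsPGroup p G) (x : {x : G // x ≠ 1}) :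
    component hp hG (Quotient.mk _ x) = Subgroup.zpowers (root p (x : G)) := rfl

theorem component_eq_of_adj [Finite G] (hp : p.Prime) (hG : IsPGroup p G)
    (v w : Quotient (menSetoid (powerGraph G))) (h : (bar (powerGraph G)).graph.Adj v w) :
    component hp hG v = component hp hG w := by
  induction v using Quotient.inductionOn with | _ x
  induction w using Quotient.inductionOn with | _ y
  exact zpowers_root_eq_of_adj hp hG (bar_adj_mk.1 h).2

theorem powerGraph_adj_of_zpowers_root_eq [Finite G] (hp : p.Prime) (hG : IsPGroup p G)
    {a y : {x : G // x ≠ 1}} (ha : orderOf (a : G) = p)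
    (hy : Subgroup.zpowers (root p (y : G)) = Subgroup.zpowers (a : G)) (hne : a ≠ y) :
    (powerGraph G).Adj a y :=
  powerGraph_adj.2 ⟨hne, Or.inr ((zpowers_root_eq_iff hp hG y.2 ha).1 hy)⟩

/-- The power of order `p` of a nontrivial element, as a vertex of the power graph. -/
noncomputable def rootVertex [Finite G] (hp : p.Prime) (hG : IsPGroup p G) (x : {x : G // x ≠ 1}) :
    {x : G // x ≠ 1} :=
  ⟨root p (x : G), ne_one_of_orderOf_eq hp (orderOf_root hp hG x.2)⟩

theorem exists_dominating [Finite G] (hp : p.Prime) (hG : IsPGroup p G)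
    (v : Quotient (menSetoid (powerGraph G))) : ∃ d, component hp hG d = component hp hG v ∧
      ∀ w, component hp hG w = component hp hG v → w ≠ d → (bar (powerGraph G)).graph.Adj d w := by
  induction v using Quotient.inductionOn with | _ x
  have ho := orderOf_root hp hG x.2
  refine ⟨Quotient.mk _ (rootVertex hp hG x), zpowers_root_of_orderOf_eq hp ho, fun w hw hne => ?_⟩
  induction w using Quotient.inductionOn with | _ y
  refine bar_adj_mk.2 ⟨hne.symm, powerGraph_adj_of_zpowers_root_eq hp hG ho hw fun h => hne ?_⟩
  rw [h]

/-- An automorphism maps the elements above `x` to as many elements. -/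
theorem ncard_mem_zpowers_eq_of_aut [Finite G] (hp : p.Prime) (hG : IsPGroup p G)
    (φ : (bar (powerGraph G)).Aut) {x y : {x : G // x ≠ 1}}
    (h : φ.1 (Quotient.mk _ x) = Quotient.mk _ y) :
    Set.ncard {z : G | root p (x : G) ∈ Subgroup.zpowers z} =
      Set.ncard {z : G | root p (y : G) ∈ Subgroup.zpowers z} := by
  have key : ∀ x : {x : G // x ≠ 1}, Set.ncard {z : G | root p (x : G) ∈ Subgroup.zpowers z} =
      Set.ncard {z : {x : G // x ≠ 1} |
        component hp hG (Quotient.mk _ z) = component hp hG (Quotient.mk _ x)} := by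
    intro x
    rw [← Set.ncard_image_of_injective _ Subtype.val_injective]
    congr 1
    ext z
    simp only [Set.mem_ofPred_eq, Set.mem_image, Subtype.exists, exists_and_right, exists_eq_right]
    have ho := orderOf_root hp hG x.2
    constructor
    · intro hz
      have hz1 : z ≠ 1 := by
        rintro rfl
        rw [Subgroup.zpowers_one_eq_bot, Subgroup.mem_bot] at hz
        exact ne_one_of_orderOf_eq hp ho hz
      exact ⟨hz1, (zpowers_root_eq_iff hp hG hz1 ho).2 hz⟩
    · rintro ⟨hz1, hz⟩
      exact (zpowers_root_eq_iff hp hG hz1 ho).1 hz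
  -- Lifting `φ` to the elements themselves allows components to be compared by their number of
  -- elements rather than of classes.
  obtain ⟨σ, hσ⟩ := exists_perm_of_bar_aut φ
  have hmap := fun φ v w => (bar (powerGraph G)).aut_map_component (component hp hG)
    (component_eq_of_adj hp hG) (exists_dominating hp hG) φ (v := v) (w := w)
  rw [key, key, ← Set.ncard_image_of_injective {z : {x : G // x ≠ 1} |
    component hp hG (Quotient.mk _ z) = component hp hG (Quotient.mk _ x)} σ.injective]
  congr 1
  ext z
  obtain ⟨z, rfl⟩ := σ.surjective z
  rw [σ.injective.mem_set_image, Set.mem_ofPred_eq, Set.mem_ofPred_eq, hσ, ← h]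
  refine ⟨hmap φ _ _, fun h' => ?_⟩
  simpa using hmap φ⁻¹ _ _ h'

/-- Automorphisms preserve the height of the element of order `p` below the elements of a class. -/
theorem eq_of_aut_of_mem_H [Finite G] (hp : p.Prime) (hG : IsPGroup p G)
    (φ : (bar (powerGraph G)).Aut) {x y : {x : G // x ≠ 1}}
    (h : φ.1 (Quotient.mk _ x) = Quotient.mk _ y) {s t : ℕ} (hs : 1 ≤ s) (ht : 1 ≤ t)
    (hx : rootVertex hp hG x ∈ H p G s) (hy : rootVertex hp hG y ∈ H p G t) : s = t := by
  have hcard := ncard_mem_zpowers_eq_of_aut hp hG φ h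
  rw [mem_H_iff hp hs] at hx
  rw [mem_H_iff hp ht] at hy
  rcases lt_trichotomy s t with hst | hst | hst
  · exact absurd hcard (ncard_mem_zpowers_lt hp hG hx.1 hy.1 hx.2.2
      (exists_pow_pow_eq_of_le (by omega) hy.2.1)).ne
  · exact hst
  · exact absurd hcard (ncard_mem_zpowers_lt hp hG hy.1 hx.1 hy.2.2
      (exists_pow_pow_eq_of_le (by omega) hx.2.1)).ne'

/-- A group automorphism carrying one root to the other acts on the power graph, hence on its
classes. -/
theorem exists_aut_component_eq [Finite G] (hp : p.Prime) (hG : IsPGroup p G)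
    {x y : {x : G // x ≠ 1}} {t : ℕ} (ht : 1 ≤ t) (hx : rootVertex hp hG x ∈ H p G t)
    (hy : rootVertex hp hG y ∈ H p G t) : ∃ φ : (bar (powerGraph G)).Aut,
      component hp hG (φ.1 (Quotient.mk _ x)) = component hp hG (Quotient.mk _ y) := by
  rw [mem_H_iff hp ht] at hx hy
  obtain ⟨ψ, hψ⟩ := exists_mulEquiv_apply_eq hp hG (h := t - 1) hx.1 hy.1 hx.2.1 hy.2.1
    (by rw [Nat.sub_add_cancel ht]; exact hx.2.2) (by rw [Nat.sub_add_cancel ht]; exact hy.2.2)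
  obtain ⟨φ, hφ⟩ := exists_bar_aut (powerGraphIso ψ)
  refine ⟨φ, ?_⟩
  rw [hφ, component_mk, component_mk]
  refine (zpowers_root_eq_iff hp hG (powerGraphIso ψ x).2 hy.1).2 ?_
  change root p (y : G) ∈ Subgroup.zpowers (ψ x)
  rw [← show ψ (root p (x : G)) = root p (y : G) from hψ, root, map_pow]
  exact Subgroup.npow_mem_zpowers _ _

/-- The neighbors of `a` outside `⟨a⟩` form its component without `⟨a⟩`, and each nontrivial element
of `⟨a⟩` again has order `p`, hence dominates the component. -/
theorem nonempty_hat_aut_mulEquiv [Finite G] (hp : p.Prime) (hG : IsPGroup p G)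
    {a : {x : G // x ≠ 1}} (ha : orderOf (a : G) = p) : Nonempty ((hat a).Aut ≃*
      ((bar (powerGraph G)).induce
        {v | component hp hG v = component hp hG (Quotient.mk _ a)}).Aut) := by
  have hroot := zpowers_root_of_orderOf_eq hp ha
  refine nonempty_bar_induce_aut_mulEquiv (powerGraph G)
    {y | component hp hG (Quotient.mk _ y) = component hp hG (Quotient.mk _ a)} _ _
    (fun y => Iff.rfl) ?_ ?_ ?_ a rfl ?_
  · rintro y ⟨hy, -⟩
    exact (zpowers_root_eq_of_adj hp hG hy).symm
  · intro y z hyz hy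
    exact (zpowers_root_eq_of_adj hp hG hyz).symm.trans hy
  · intro k hk hkS y hy hne
    have hka : (k : G) ∈ Subgroup.zpowers (a : G) := by
      by_contra hka
      refine hkS ⟨powerGraph_adj_of_zpowers_root_eq hp hG ha (hk.trans hroot) ?_, hka⟩
      rintro rfl
      exact hka (Subgroup.mem_zpowers _)
    have hko := orderOf_eq_of_mem_zpowers hp ha hka k.2
    exact powerGraph_adj_of_zpowers_root_eq hp hG hko
      ((hy.trans hk.symm).trans (zpowers_root_of_orderOf_eq hp hko)) hne.symm
  · rintro ⟨-, h⟩
    exact h (Subgroup.mem_zpowers _)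

end Component

end PowerGraph

/-! ### Assembly: heights as types of components -/

theorem corollary4p8 {G : Type*} [CommGroup G] [Finite G] (p : ℕ) (hp : p.Prime)
    (hG : IsPGroup p G)
    (α : (t : {t : ℕ // 1 ≤ t ∧ (PowerGraph.H p G t).Nonempty}) → {x : G // x ≠ 1})
    (hα : ∀ t : {t : ℕ // 1 ≤ t ∧ (PowerGraph.H p G t).Nonempty},
      α t ∈ PowerGraph.H p G t) :
    (∀ t : {t : ℕ // 1 ≤ t ∧ (PowerGraph.H p G t).Nonempty},
      (p - 1) ∣ (PowerGraph.H p G t).ncard) ∧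
    Nonempty
      ((PowerGraph.bar (PowerGraph.powerGraph G)).Aut ≃*
        ((t : {t : ℕ // 1 ≤ t ∧ (PowerGraph.H p G t).Nonempty}) →
          PowerGraph.WreathSym (PowerGraph.hat (α t)).Aut
            ((PowerGraph.H p G t).ncard / (p - 1)))) := by
  open PowerGraph in
  refine ⟨fun t => ⟨_, (ncard_H_eq hp t.2.1).trans (mul_comm _ _)⟩, ?_⟩
  have hlevel : ∀ v : Quotient (menSetoid (powerGraph G)),
      ∃ t : {t : ℕ // 1 ≤ t ∧ (H p G t).Nonempty}, rootVertex hp hG v.out ∈ H p G t := by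
    intro v
    obtain ⟨t, ht, hv⟩ := exists_mem_H hp hG (x := rootVertex hp hG v.out)
      (orderOf_root hp hG v.out.2)
    exact ⟨⟨t, ht, _, hv⟩, hv⟩
  choose τ hτ using hlevel
  have hout : ∀ v, component hp hG v = Subgroup.zpowers (rootVertex hp hG v.out : G) := by
    intro v
    conv_lhs => rw [← Quotient.out_eq v]
    rfl
  -- The type `τ` was chosen through representatives; it is the height index of any generator of the
  -- component's subgroup.
  have hmem : ∀ v (x : {x : G // x ≠ 1}), component hp hG v = Subgroup.zpowers (x : G) →
      ∀ t : {t : ℕ // 1 ≤ t ∧ (H p G t).Nonempty}, x ∈ H p G t ↔ τ v = t := by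
    intro v x hvx t
    have hx : x ∈ H p G (τ v) :=
      mem_H_of_zpowers_eq hp (τ v).2.1 ((hout v).symm.trans hvx) (hτ v)
    constructor
    · exact fun h => Subtype.ext (eq_of_mem_H hp (τ v).2.1 t.2.1 hx h)
    · rintro rfl
      exact hx
  have hcα : ∀ t, component hp hG (Quotient.mk _ (α t)) = Subgroup.zpowers (α t : G) :=
    fun t => zpowers_root_of_orderOf_eq hp (hα t).1
  obtain ⟨E⟩ := (bar (powerGraph G)).nonempty_aut_mulEquiv_pi_wreath (component hp hG) τ
    (component_eq_of_adj hp hG) (exists_dominating hp hG)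
    (fun v w h => ((hmem v _ (h.trans (hout w)) (τ w)).1 (hτ w)))
    (fun φ v => by
      refine Subtype.ext (eq_of_aut_of_mem_H hp hG φ⁻¹ (x := (φ.1 v).out) (y := v.out) ?_
        (τ _).2.1 (τ _).2.1 (hτ _) (hτ _))
      rw [Quotient.out_eq, Quotient.out_eq, WeightedGraph.aut_inv_apply_self])
    (fun v w h => by
      obtain ⟨φ, hφ⟩ := exists_aut_component_eq hp hG (τ v).2.1 (hτ v) (h ▸ hτ w)
      rw [Quotient.out_eq, Quotient.out_eq] at hφ
      exact ⟨φ, hφ⟩)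
    (fun t => Quotient.mk _ (α t)) (fun t => (hmem _ _ (hcα t) t).1 (hα t))
    (fun t => (H p G t).ncard / (p - 1))
    (fun t => by
      have himage : component hp hG '' {v | τ v = t} =
          (fun x : {x : G // x ≠ 1} => Subgroup.zpowers (x : G)) '' H p G t := by
        ext C
        constructor
        · rintro ⟨v, rfl, rfl⟩
          exact ⟨_, hτ v, (hout v).symm⟩
        · rintro ⟨x, hx, rfl⟩
          have hc : component hp hG (Quotient.mk _ x) = Subgroup.zpowers (x : G) :=
            zpowers_root_of_orderOf_eq hp hx.1
          exact ⟨Quotient.mk _ x, (hmem _ _ hc t).1 hx, hc⟩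
      rw [himage, ncard_H_eq hp t.2.1, Nat.mul_div_cancel _ (Nat.sub_pos_of_lt hp.one_lt)]
      exact ⟨(Finite.equivFin _).symm⟩)
  refine ⟨E.trans (MulEquiv.piCongrRight fun t => SemidirectProduct.congr
    (MulEquiv.piCongrRight fun _ => (nonempty_hat_aut_mulEquiv hp hG (hα t).1).some.symm)
    (MulEquiv.refl _) fun σ => rfl)⟩
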